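/- Let $d\ge 2$ and $n\ge 0$ be integers and let $t$ be a real number with $-\frac{1}{d-1}\le t\le \frac{1}{d+1}$. Let $\Gamma_t:\mathcal L(\mathbb C^d)\to\mathcal L(\mathbb C^d)$ be the transpose-depolarizing channel $$\Gamma_t(X)=t\,X^{T}+(1-t)\,\mathrm{Tr}(X)\,\frac{I_d}{d},$$ where $T$ is the transpose in the standard basis, and let $\Phi_d=|\Phi_d\rangle\langle\Phi_d|$ with $|\Phi_d\rangle=\frac{1}{\sqrt d}\sum_{i=1}^d|i\rangle\otimes|i\rangle\in A\otimes A'$, $A=A'=\mathbb C^d$. Regard $\Phi_d^{\otimes n}$ as an operator on $A^{\otimes n}\otimes A'^{\otimes n}$. For a finite-dimensional Hilbert space $B$ and a completely positive trace-preserving (CPTP) map $\Lambda:\mathcal L(A'^{\otimes n})\to\mathcal L(B)$ put $$\omega^{(n)}(\Lambda)=(\Gamma_t^{\otimes n}\otimes\mathrm{id}_B)\bigl((\mathrm{id}_{A^{\otimes n}}\otimes\Lambda)(\Phi_d^{\otimes n})\bigr),$$ and define $$\upsilon_2(\Gamma_t^{\otimes n})=\sup_{B,\ \Lambda}\ \bigl\|\omega^{(n)}(\Lambda)\bigr\|_2,\qquad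 \|X\|_2=\bigl(\mathrm{Tr}\,X^\dagger X\bigr)^{1/2},$$ the supremum being over all finite-dimensional $B$ and all CPTP maps $\Lambda:\mathcal L(A'^{\otimes n})\to\mathcal L(B)$. Then this supremum is finite and, with $D_n=d^{2n}$, $$\upsilon_2(\Gamma_t^{\otimes n})=\max_{\Lambda:\mathcal L(A'^{\otimes n})\to\mathcal L(\mathbb C^{D_n})\ \mathrm{CPTP}}\ \bigl\|\omega^{(n)}(\Lambda)\bigr\|_2,$$ where the maximum on the right is attained. In particular, the supremum over all finite output dimensions is a maximum. -/

import Mathlib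

open scoped Matrix Kronecker ComplexOrder

noncomputable section

namespace FiniteOutput

/-- Linear maps `𝓛(ℂ^ι) → 𝓛(ℂ^κ)`; operators are matrices in the fixed orthonormal bases. -/
abbrev SuperOp (ι κ : Type*) := Matrix ι ι ℂ →ₗ[ℂ] Matrix κ κ ℂ

/-- `Φ ⊗ id_B`, acting blockwise. -/
def tensorId {ι κ : Type*} (Φ : SuperOp ι κ) (B : Type*) : SuperOp (ι × B) (κ × B) where
  toFun X := Matrix.of fun p q =>
    Φ (Matrix.of fun i j => X (i, p.2) (j, q.2)) p.1 q.1
  map_add' X Y := by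
    ext p q
    exact congrFun (congrFun (Φ.map_add (Matrix.of fun i j => X (i, p.2) (j, q.2))
      (Matrix.of fun i j => Y (i, p.2) (j, q.2))) p.1) q.1
  map_smul' c X := by
    ext p q
    exact congrFun (congrFun (Φ.map_smul c (Matrix.of fun i j => X (i, p.2) (j, q.2))) p.1) q.1

/-- `id_A ⊗ Φ`, acting blockwise. -/
def idTensor (A : Type*) {ι κ : Type*} (Φ : SuperOp ι κ) : SuperOp (A × ι) (A × κ) where
  toFun X := Matrix.of fun p q =>
    Φ (Matrix.of fun i j => X (p.1, i) (q.1, j)) p.2 q.2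
  map_add' X Y := by
    ext p q
    exact congrFun (congrFun (Φ.map_add (Matrix.of fun i j => X (p.1, i) (q.1, j))
      (Matrix.of fun i j => Y (p.1, i) (q.1, j))) p.2) q.2
  map_smul' c X := by
    ext p q
    exact congrFun (congrFun (Φ.map_smul c (Matrix.of fun i j => X (p.1, i) (q.1, j))) p.2) q.2

/-- `Φ ⊗ id_B` sends `X ⊗ Y` to `Φ(X) ⊗ Y`. -/
theorem tensorId_kronecker {ι κ B : Type*} (Φ : SuperOp ι κ) (X : Matrix ι ι ℂ)
    (Y : Matrix B B ℂ) : tensorId Φ B (X ⊗ₖ Y) = Φ X ⊗ₖ Y := by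
  ext p q
  have h : (Matrix.of fun i j => (X ⊗ₖ Y) (i, p.2) (j, q.2)) = Y p.2 q.2 • X := by
    ext i j
    simp [Matrix.kroneckerMap_apply, mul_comm]
  have h' : tensorId Φ B (X ⊗ₖ Y) p q =
      Φ (Matrix.of fun i j => (X ⊗ₖ Y) (i, p.2) (j, q.2)) p.1 q.1 := rfl
  rw [h', h, map_smul]
  simp [Matrix.kroneckerMap_apply, mul_comm]

/-- `id_A ⊗ Φ` sends `X ⊗ Y` to `X ⊗ Φ(Y)`. -/
theorem idTensor_kronecker {A ι κ : Type*} (Φ : SuperOp ι κ) (X : Matrix A A ℂ)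
    (Y : Matrix ι ι ℂ) : idTensor A Φ (X ⊗ₖ Y) = X ⊗ₖ Φ Y := by
  ext p q
  have h : (Matrix.of fun i j => (X ⊗ₖ Y) (p.1, i) (q.1, j)) = X p.1 q.1 • Y := by
    ext i j
    simp [Matrix.kroneckerMap_apply]
  have h' : idTensor A Φ (X ⊗ₖ Y) p q =
      Φ (Matrix.of fun i j => (X ⊗ₖ Y) (p.1, i) (q.1, j)) p.2 q.2 := rfl
  rw [h', h, map_smul]
  simp [Matrix.kroneckerMap_apply]

/-- Complete positivity: `id_{ℂ^k} ⊗ Φ` is positive for every `k`. -/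
def IsCP {ι κ : Type*} (Φ : SuperOp ι κ) : Prop :=
  ∀ (k : ℕ) (X : Matrix (Fin k × ι) (Fin k × ι) ℂ),
    X.PosSemidef → (idTensor (Fin k) Φ X).PosSemidef

/-- Completely positive trace-preserving maps. -/
structure IsCPTP {ι κ : Type*} [Fintype ι] [Fintype κ] (Φ : SuperOp ι κ) : Prop where
  cp : IsCP Φ
  tp : ∀ X : Matrix ι ι ℂ, (Φ X).trace = X.trace

/-- Schatten 2-norm `‖X‖₂ = (Tr X†X)^{1/2}`. -/
def schattenTwo {ι : Type*} [Fintype ι] (X : Matrix ι ι ℂ) : ℝ :=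
  Real.sqrt (Xᴴ * X).trace.re

/-- `X₁ ⊗ ⋯ ⊗ Xₙ` in the product basis of `(ℂ^ι)^{⊗n}`, which is indexed by `Fin n → ι`. -/
def piKron {n : ℕ} {ι : Type*} (X : Fin n → Matrix ι ι ℂ) :
    Matrix (Fin n → ι) (Fin n → ι) ℂ :=
  Matrix.of fun a b => ∏ k, X k (a k) (b k)

/-- The tensor power `Φ^{⊗n}`, given by its matrix coefficients in the product basis:
`Φ^{⊗n}(|i⟩⟨j|) = ⨂ₖ Φ(|iₖ⟩⟨jₖ|)`, extended linearly. -/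
def tensorPow {ι κ : Type*} [Fintype ι] [DecidableEq ι] (Φ : SuperOp ι κ) (n : ℕ) :
    SuperOp (Fin n → ι) (Fin n → κ) where
  toFun X := ∑ i, ∑ j, X i j • piKron fun k => Φ (Matrix.single (i k) (j k) 1)
  map_add' X Y := by
    simp only [Matrix.add_apply, add_smul, Finset.sum_add_distrib]
  map_smul' c X := by
    simp only [Matrix.smul_apply, smul_eq_mul, mul_smul, Finset.smul_sum, RingHom.id_apply]

/-- `Φ^{⊗n}(X₁ ⊗ ⋯ ⊗ Xₙ) = Φ(X₁) ⊗ ⋯ ⊗ Φ(Xₙ)`. -/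
theorem tensorPow_piKron {ι κ : Type*} [Fintype ι] [DecidableEq ι] (Φ : SuperOp ι κ) {n : ℕ}
    (X : Fin n → Matrix ι ι ℂ) :
    tensorPow Φ n (piKron X) = piKron fun k => Φ (X k) := by
  have key : ∀ (M : Matrix ι ι ℂ) (a b : κ),
      Φ M a b = ∑ i, ∑ j, M i j * Φ (Matrix.single i j 1) a b := by
    intro M a b
    conv_lhs => rw [Matrix.matrix_eq_sum_single M]
    simp only [map_sum, Matrix.sum_apply]
    refine Finset.sum_congr rfl fun i _ => Finset.sum_congr rfl fun j _ => ?_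
    have : Matrix.single i j (M i j) = M i j • Matrix.single i j (1 : ℂ) := by
      rw [Matrix.smul_single, smul_eq_mul, mul_one]
    rw [this, map_smul]
    rfl
  ext a b
  simp only [tensorPow, piKron, LinearMap.coe_mk, AddHom.coe_mk, Matrix.sum_apply,
    Matrix.smul_apply, Matrix.of_apply, smul_eq_mul]
  simp_rw [key (X _), Fintype.prod_sum, ← Finset.prod_mul_distrib]

/-- The transpose-depolarizing map `Γ_t(X) = t Xᵀ + (1 - t) Tr(X) I_d / d`. -/
def transposeDepolarizing (d : ℕ) (t : ℝ) : SuperOp (Fin d) (Fin d) where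
  toFun X := (t : ℂ) • Xᵀ + ((1 - (t : ℂ)) * X.trace) • ((d : ℂ)⁻¹ • (1 : Matrix _ _ ℂ))
  map_add' X Y := by
    rw [Matrix.transpose_add, Matrix.trace_add, mul_add, add_smul, smul_add]
    abel
  map_smul' c X := by
    rw [Matrix.transpose_smul, Matrix.trace_smul, RingHom.id_apply, smul_add, smul_comm,
      smul_eq_mul, mul_left_comm, mul_smul c]

/-- `|Φ_d⟩ = d^{-1/2} ∑ᵢ |i⟩ ⊗ |i⟩`. -/
def maxEntVec (d : ℕ) : Fin d × Fin d → ℂ :=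
  fun p => if p.1 = p.2 then ((Real.sqrt d : ℝ) : ℂ)⁻¹ else 0

/-- `Φ_d = |Φ_d⟩⟨Φ_d|`. -/
def maxEnt (d : ℕ) : Matrix (Fin d × Fin d) (Fin d × Fin d) ℂ :=
  Matrix.vecMulVec (maxEntVec d) (star (maxEntVec d))

/-- `Φ_d^{⊗n}` as an operator on `A^{⊗n} ⊗ A'^{⊗n}`, i.e. with the factors
`(A₁ ⊗ A'₁) ⊗ ⋯ ⊗ (Aₙ ⊗ A'ₙ)` regrouped. -/
def maxEntPow (d n : ℕ) :
    Matrix ((Fin n → Fin d) × (Fin n → Fin d)) ((Fin n → Fin d) × (Fin n → Fin d)) ℂ :=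
  (piKron fun _ : Fin n => maxEnt d).submatrix
    (fun p k => (p.1 k, p.2 k)) (fun p k => (p.1 k, p.2 k))

/-- `ω⁽ⁿ⁾(Λ) = (Γ_t^{⊗n} ⊗ id_B)((id ⊗ Λ)(Φ_d^{⊗n}))` for `B = ℂ^m`. -/
def omega (d : ℕ) (t : ℝ) (n m : ℕ) (Λ : SuperOp (Fin n → Fin d) (Fin m)) :
    Matrix ((Fin n → Fin d) × Fin m) ((Fin n → Fin d) × Fin m) ℂ :=
  tensorId (tensorPow (transposeDepolarizing d t) n) (Fin m)
    (idTensor (Fin n → Fin d) Λ (maxEntPow d n))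

/-- The values `‖ω⁽ⁿ⁾(Λ)‖₂` over CPTP maps `Λ` with output space `ℂ^m`. -/
def valuesAt (d : ℕ) (t : ℝ) (n m : ℕ) : Set ℝ :=
  {v | ∃ Λ : SuperOp (Fin n → Fin d) (Fin m), IsCPTP Λ ∧ v = schattenTwo (omega d t n m Λ)}

/-- The values `‖ω⁽ⁿ⁾(Λ)‖₂` over CPTP maps `Λ` with any finite-dimensional output space. -/
def allValues (d : ℕ) (t : ℝ) (n : ℕ) : Set ℝ :=
  ⋃ m : ℕ, valuesAt d t n m

/-- `υ₂(Γ_t^{⊗n})`, the supremum over all finite output dimensions. -/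
def upsilonTwo (d : ℕ) (t : ℝ) (n : ℕ) : ℝ :=
  sSup (allValues d t n)

end FiniteOutput

end

noncomputable section

namespace FiniteOutput

/-! For a fixed output space `ℂ^m`, channels correspond to their Choi matrices, which form a compact
convex set, and the 2-norm of the output is a convex continuous function of the Choi matrix. So it
suffices to bound it at extreme points (`norm_outputVec_le_of_extremePoints`).

With `N` the input dimension, an extreme Choi matrix has rank `r ≤ N`
(`exists_factor_of_mem_extremePoints`): otherwise `r² > N²` leaves room for a Hermitian perturbation
inside its range with zero partial trace. Hence an extreme channel is `X ↦ M (X ⊗ 1_r) M†` with `M`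
having at most `N²` columns.

The output 2-norm and trace preservation see `M` only through `M† M`
(`schattenTwo_stinespring_congr`), a Gram matrix of size at most `N²`, realizable by vectors in
`ℂ^(N²)`. So no output space beats dimension `N² = d^(2n)`, where compactness gives a maximum. -/

variable {a b κ σ A A' : Type*}

/-! ### Stinespring operators and their Gram matrices -/

/-- The superoperator `X ↦ M (X ⊗ 1_σ) M†`, in Stinespring form. -/
def stinespring [Fintype a] [Fintype σ] [DecidableEq σ] (M : Matrix b (a × σ) ℂ) :
    SuperOp a b where
  toFun X := M * (X ⊗ₖ (1 : Matrix σ σ ℂ)) * Mᴴ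
  map_add' X Y := by rw [Matrix.add_kronecker, Matrix.mul_add, Matrix.add_mul]
  map_smul' c X := by
    rw [Matrix.smul_kronecker, Matrix.mul_smul, Matrix.smul_mul, RingHom.id_apply]

theorem stinespring_apply [Fintype a] [Fintype σ] [DecidableEq σ] (M : Matrix b (a × σ) ℂ)
    (X : Matrix a a ℂ) : stinespring M X = M * (X ⊗ₖ (1 : Matrix σ σ ℂ)) * Mᴴ := rfl

/-- The operator `X ⊗ 1_σ` on `A ⊗ (a ⊗ σ)`, for `X` on `A ⊗ a`. -/
def ampliation (σ : Type*) [DecidableEq σ] (X : Matrix (A × a) (A × a) ℂ) :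
    Matrix (A × a × σ) (A × a × σ) ℂ :=
  (X ⊗ₖ (1 : Matrix σ σ ℂ)).submatrix (fun p => ((p.1, p.2.1), p.2.2))
    (fun p => ((p.1, p.2.1), p.2.2))

theorem one_kronecker_mul_mul_apply [Fintype A] [DecidableEq A] [Fintype κ] (M : Matrix b κ ℂ)
    (Y : Matrix (A × κ) (A × κ) ℂ) (p q : A × b) :
    (((1 : Matrix A A ℂ) ⊗ₖ M) * Y * ((1 : Matrix A A ℂ) ⊗ₖ M)ᴴ) p q =
      (M * (Matrix.of fun x y => Y (p.1, x) (q.1, y)) * Mᴴ) p.2 q.2 := by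
  simp [Matrix.mul_apply, Fintype.sum_prod_type, Matrix.kroneckerMap_apply, Matrix.one_apply,
    Matrix.conjTranspose_apply, Finset.sum_mul, ite_mul, mul_ite, apply_ite star]

theorem idTensor_stinespring [Fintype a] [Fintype σ] [DecidableEq σ] [Fintype A] [DecidableEq A]
    (M : Matrix b (a × σ) ℂ) (X : Matrix (A × a) (A × a) ℂ) :
    idTensor A (stinespring M) X =
      ((1 : Matrix A A ℂ) ⊗ₖ M) * ampliation σ X * ((1 : Matrix A A ℂ) ⊗ₖ M)ᴴ := by
  ext p q
  rw [one_kronecker_mul_mul_apply]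
  rfl

/-- `Ψ` and conjugation by `M` act on different tensor factors, so they commute; entrywise this is
the linearity of `Ψ`. -/
theorem tensorId_conj [Fintype A] [DecidableEq A] [Fintype A'] [DecidableEq A'] [Fintype κ]
    (Ψ : SuperOp A A') (M : Matrix b κ ℂ) (Y : Matrix (A × κ) (A × κ) ℂ) :
    tensorId Ψ b (((1 : Matrix A A ℂ) ⊗ₖ M) * Y * ((1 : Matrix A A ℂ) ⊗ₖ M)ᴴ) =
      ((1 : Matrix A' A' ℂ) ⊗ₖ M) * tensorId Ψ κ Y * ((1 : Matrix A' A' ℂ) ⊗ₖ M)ᴴ := by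
  ext p q
  rw [one_kronecker_mul_mul_apply]
  have h : (Matrix.of fun i j =>
      (((1 : Matrix A A ℂ) ⊗ₖ M) * Y * ((1 : Matrix A A ℂ) ⊗ₖ M)ᴴ) (i, p.2) (j, q.2)) =
      ∑ y, ∑ x, (M p.2 x * star (M q.2 y)) • (Matrix.of fun i j => Y (i, x) (j, y)) := by
    ext i j
    rw [Matrix.of_apply, one_kronecker_mul_mul_apply]
    simp only [Matrix.mul_apply, Matrix.of_apply, Matrix.conjTranspose_apply, Finset.sum_mul,
      Matrix.sum_apply, Matrix.smul_apply, smul_eq_mul]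
    exact Finset.sum_congr rfl fun y _ => Finset.sum_congr rfl fun x _ => by ring
  change Ψ (Matrix.of fun i j => _) p.1 q.1 = _
  rw [h]
  simp only [map_sum, map_smul, Matrix.mul_apply, Matrix.of_apply, Matrix.conjTranspose_apply,
    Finset.sum_mul, Matrix.sum_apply, Matrix.smul_apply, smul_eq_mul]
  refine Finset.sum_congr rfl fun y _ => Finset.sum_congr rfl fun x _ => ?_
  change _ = M p.2 x * Ψ (Matrix.of fun i j => Y (i, x) (j, y)) p.1 q.1 * _
  ring

theorem posSemidef_ampliation [Finite A] [Finite a] [Finite σ] [DecidableEq σ]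
    {X : Matrix (A × a) (A × a) ℂ} (hX : X.PosSemidef) : (ampliation σ X).PosSemidef :=
  (hX.kronecker Matrix.PosSemidef.one).submatrix _

theorem isCP_stinespring [Fintype a] [Fintype b] [Fintype σ] [DecidableEq σ]
    (M : Matrix b (a × σ) ℂ) : IsCP (stinespring M) := by
  intro k X hX
  rw [idTensor_stinespring]
  exact (posSemidef_ampliation hX).mul_mul_conjTranspose_same _

theorem trace_stinespring [Fintype a] [Fintype b] [Fintype σ] [DecidableEq σ]
    (M : Matrix b (a × σ) ℂ) (X : Matrix a a ℂ) :
    (stinespring M X).trace = ((Mᴴ * M) * (X ⊗ₖ (1 : Matrix σ σ ℂ))).trace := by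
  rw [stinespring_apply, Matrix.trace_mul_comm, Matrix.mul_assoc]

/-- Cyclicity of the trace pairs each `K` with a `K†`, so the output space `b` disappears and only
`K† K` remains. -/
theorem trace_conj_conjTranspose_mul_self [Fintype b] [Fintype κ] [Fintype A'] [DecidableEq A']
    (K : Matrix b κ ℂ) (Z : Matrix (A' × κ) (A' × κ) ℂ) :
    ((((1 : Matrix A' A' ℂ) ⊗ₖ K) * Z * ((1 : Matrix A' A' ℂ) ⊗ₖ K)ᴴ)ᴴ *
        (((1 : Matrix A' A' ℂ) ⊗ₖ K) * Z * ((1 : Matrix A' A' ℂ) ⊗ₖ K)ᴴ)).trace =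
      (((1 : Matrix A' A' ℂ) ⊗ₖ (Kᴴ * K)) * Zᴴ *
        ((1 : Matrix A' A' ℂ) ⊗ₖ (Kᴴ * K)) * Z).trace := by
  have hG : ((1 : Matrix A' A' ℂ) ⊗ₖ (Kᴴ * K)) =
      ((1 : Matrix A' A' ℂ) ⊗ₖ K)ᴴ * ((1 : Matrix A' A' ℂ) ⊗ₖ K) := by
    rw [Matrix.conjTranspose_kronecker, ← Matrix.mul_kronecker_mul, Matrix.conjTranspose_one,
      Matrix.one_mul]
  rw [hG]
  generalize (1 : Matrix A' A' ℂ) ⊗ₖ K = R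
  rw [← Matrix.mul_assoc, Matrix.trace_mul_comm]
  simp only [Matrix.conjTranspose_mul, Matrix.conjTranspose_conjTranspose, Matrix.mul_assoc]

/-- The Schatten norm of the output state depends on the Stinespring operator only through its
Gram matrix. -/
theorem schattenTwo_stinespring_congr {b' : Type*} [Fintype a] [Fintype b] [Fintype b'] [Fintype σ]
    [DecidableEq σ] [Fintype A] [DecidableEq A] [Fintype A'] [DecidableEq A'] (Ψ : SuperOp A A')
    (X : Matrix (A × a) (A × a) ℂ) {M : Matrix b (a × σ) ℂ} {M' : Matrix b' (a × σ) ℂ}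
    (h : Mᴴ * M = M'ᴴ * M') :
    schattenTwo (tensorId Ψ b (idTensor A (stinespring M) X)) =
      schattenTwo (tensorId Ψ b' (idTensor A (stinespring M') X)) := by
  rw [idTensor_stinespring, idTensor_stinespring, tensorId_conj, tensorId_conj, schattenTwo,
    schattenTwo, trace_conj_conjTranspose_mul_self, trace_conj_conjTranspose_mul_self, h]

/-- Any Gram matrix is the Gram matrix of vectors in a space of dimension at least its size. -/
theorem exists_conjTranspose_mul_self_eq {b' : Type*} [Fintype b] [Fintype b'] [Fintype κ]
    (M : Matrix b κ ℂ) (h : Fintype.card κ ≤ Fintype.card b') :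
    ∃ M' : Matrix b' κ ℂ, Mᴴ * M = M'ᴴ * M' := by
  classical
  obtain ⟨e⟩ := Function.Embedding.nonempty_of_card_le h
  open scoped MatrixOrder in
  obtain ⟨B, hB⟩ := CStarAlgebra.nonneg_iff_eq_star_mul_self.mp
    (Matrix.posSemidef_conjTranspose_mul_self M).nonneg
  -- `B` is a square factor of the Gram matrix; the columns of the identity picked by `e` form an
  -- isometry into the larger space.
  refine ⟨(1 : Matrix b' b' ℂ).submatrix id e * B, ?_⟩
  have he : ((1 : Matrix b' b' ℂ).submatrix id e)ᴴ * (1 : Matrix b' b' ℂ).submatrix id e = 1 := by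
    ext i j
    simp [Matrix.mul_apply, Matrix.one_apply]
  rw [Matrix.conjTranspose_mul, Matrix.mul_assoc, ← Matrix.mul_assoc _ _ B, he, Matrix.one_mul, hB,
    Matrix.star_eq_conjTranspose]

/-! ### Choi matrices of channels -/

/-- The superoperator whose Choi matrix is `J`. -/
def ofChoi [Fintype a] (J : Matrix (a × b) (a × b) ℂ) : SuperOp a b where
  toFun X := Matrix.of fun x y => ∑ i, ∑ j, X i j * J (i, x) (j, y)
  map_add' X Y := by
    ext x y
    simp [add_mul, Finset.sum_add_distrib]
  map_smul' c X := by
    ext x y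
    simp [mul_assoc, Finset.mul_sum]

/-- The Choi matrix `∑ |i⟩⟨j| ⊗ Λ(|i⟩⟨j|)`. -/
def choi [DecidableEq a] (Λ : SuperOp a b) : Matrix (a × b) (a × b) ℂ :=
  Matrix.of fun p q => Λ (Matrix.single p.1 q.1 1) p.2 q.2

theorem ofChoi_choi [Fintype a] [DecidableEq a] (Λ : SuperOp a b) : ofChoi (choi Λ) = Λ := by
  refine LinearMap.ext fun X => ?_
  have hX : X = ∑ i, ∑ j, X i j • Matrix.single i j (1 : ℂ) := by
    simpa [Matrix.smul_single] using Matrix.matrix_eq_sum_single X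
  ext x y
  conv_rhs => rw [hX]
  simp only [ofChoi, choi, LinearMap.coe_mk, AddHom.coe_mk, Matrix.of_apply, map_sum, map_smul,
    Matrix.sum_apply, Matrix.smul_apply, smul_eq_mul]

/-- The Choi matrices of channels: positive semidefinite with partial trace the identity. -/
def choiSet (a b : Type*) [DecidableEq a] [Fintype b] : Set (Matrix (a × b) (a × b) ℂ) :=
  {J | J.PosSemidef ∧ ∀ i j, ∑ x, J (i, x) (j, x) = (1 : Matrix a a ℂ) i j}

/-- The Choi matrix is the image of the unnormalized maximally entangled projector. `e` replaces the
reference system `a` by `Fin k`, as `IsCP` requires. -/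
theorem posSemidef_choi [Fintype a] [DecidableEq a] {Λ : SuperOp a b} (h : IsCP Λ) :
    (choi Λ).PosSemidef := by
  let e := Fintype.equivFin a
  let v : Fin (Fintype.card a) × a → ℂ := fun p => if p.1 = e p.2 then 1 else 0
  have h' := (h _ _ (Matrix.posSemidef_vecMulVec_self_star v)).submatrix
    (fun p : a × b => (e p.1, p.2))
  convert h' using 1
  ext p q
  have : (Matrix.of fun i j => Matrix.vecMulVec v (star v) (e p.1, i) (e q.1, j)) =
      Matrix.single p.1 q.1 (1 : ℂ) := by
    ext i j
    simp [v, Matrix.vecMulVec_apply, Matrix.single_apply, ← ite_and, and_comm]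
  change Λ _ p.2 q.2 = Λ _ p.2 q.2
  rw [this]

theorem choi_mem_choiSet [Fintype a] [DecidableEq a] [Fintype b] {Λ : SuperOp a b}
    (h : IsCPTP Λ) : choi Λ ∈ choiSet a b := by
  refine ⟨posSemidef_choi h.cp, fun i j => ?_⟩
  have := h.tp (Matrix.single i j 1)
  rw [Matrix.one_apply]
  split_ifs with hij
  · subst hij
    simpa [Matrix.trace, choi] using this
  · rw [Matrix.trace_single_eq_of_ne _ _ _ hij] at this
    simpa [Matrix.trace, choi] using this

/-- The columns of `W` are vectorized Kraus operators, so the rank of the Choi matrix bounds the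
environment dimension. -/
theorem ofChoi_eq_stinespring [Fintype a] [Fintype σ] [DecidableEq σ] (W : Matrix (a × b) σ ℂ) :
    ofChoi (W * Wᴴ) = stinespring (Matrix.of fun x (p : a × σ) => W (p.1, x) p.2) := by
  refine LinearMap.ext fun X => ?_
  ext x y
  simp only [ofChoi, stinespring, Matrix.mul_apply, Fintype.sum_prod_type,
    LinearMap.coe_mk, AddHom.coe_mk, Matrix.of_apply, Matrix.conjTranspose_apply,
    Matrix.kroneckerMap_apply, Matrix.one_apply, mul_ite, mul_one, mul_zero, Finset.sum_ite_eq',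
    Finset.mem_univ, if_true, Finset.sum_mul, Finset.mul_sum]
  rw [Finset.sum_comm]
  refine Finset.sum_congr rfl fun j _ => ?_
  rw [Finset.sum_comm]
  exact Finset.sum_congr rfl fun s _ => Finset.sum_congr rfl fun i _ => by ring

theorem trace_ofChoi [Fintype a] [DecidableEq a] [Fintype b] {J : Matrix (a × b) (a × b) ℂ}
    (hJ : J ∈ choiSet a b) (X : Matrix a a ℂ) : (ofChoi J X).trace = X.trace := by
  have : (ofChoi J X).trace = ∑ i, ∑ j, X i j * ∑ x, J (i, x) (j, x) := by
    simp only [ofChoi, Matrix.trace, Matrix.diag, LinearMap.coe_mk, AddHom.coe_mk, Matrix.of_apply,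
      Finset.mul_sum]
    rw [Finset.sum_comm]
    exact Finset.sum_congr rfl fun i _ => Finset.sum_comm
  rw [this]
  simp [hJ.2, Matrix.one_apply, Matrix.trace]

theorem exists_eq_mul_conjTranspose [Fintype κ] {J : Matrix κ κ ℂ} (hJ : J.PosSemidef) :
    ∃ W : Matrix κ κ ℂ, J = W * Wᴴ := by
  classical
  open scoped MatrixOrder in
  obtain ⟨B, hB⟩ := CStarAlgebra.nonneg_iff_eq_star_mul_self.mp hJ.nonneg
  exact ⟨Bᴴ, by rw [hB, Matrix.conjTranspose_conjTranspose, Matrix.star_eq_conjTranspose]⟩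

theorem isCPTP_ofChoi [Fintype a] [DecidableEq a] [Fintype b] {J : Matrix (a × b) (a × b) ℂ}
    (hJ : J ∈ choiSet a b) : IsCPTP (ofChoi J) := by
  classical
  refine ⟨?_, trace_ofChoi hJ⟩
  obtain ⟨W, rfl⟩ := exists_eq_mul_conjTranspose hJ.1
  rw [ofChoi_eq_stinespring]
  exact isCP_stinespring _

/-! ### Rank of extreme Choi matrices -/

/-- The spectral decomposition of a Hermitian matrix, in product form. -/
theorem exists_unitary_diagonal [Fintype κ] [DecidableEq κ] {J : Matrix κ κ ℂ}
    (hJ : J.IsHermitian) : ∃ (U : Matrix κ κ ℂ) (l : κ → ℝ), Uᴴ * U = 1 ∧ U * Uᴴ = 1 ∧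
      J = U * Matrix.diagonal (fun i => (l i : ℂ)) * Uᴴ ∧ (J.PosSemidef → ∀ i, 0 ≤ l i) := by
  refine ⟨hJ.eigenvectorUnitary.1, hJ.eigenvalues, Unitary.coe_star_mul_self hJ.eigenvectorUnitary,
    Unitary.coe_mul_star_self hJ.eigenvectorUnitary, ?_, fun h i => h.eigenvalues_nonneg i⟩
  conv_lhs => rw [hJ.spectral_theorem, Unitary.conjStarAlgAut_apply]
  rfl

/-- A positive semidefinite matrix factors through linearly independent columns. -/
theorem exists_injective_factor [Fintype κ] {J : Matrix κ κ ℂ} (hJ : J.PosSemidef) :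
    ∃ (r : ℕ) (W : Matrix κ (Fin r) ℂ), J = W * Wᴴ ∧ IsUnit (Wᴴ * W) := by
  classical
  obtain ⟨U, l, hUU, -, hd, hl⟩ := exists_unitary_diagonal hJ.1
  have hsq : ∀ i, (Real.sqrt (l i) : ℂ) * (Real.sqrt (l i) : ℂ) = l i := fun i => by
    rw [← Complex.ofReal_mul, Real.mul_self_sqrt (hl hJ i)]
  -- Only eigenvectors with nonzero eigenvalue are kept, which makes `W† W` diagonal and invertible.
  let e := (Fintype.equivFin {i // l i ≠ 0}).symm
  refine ⟨_, Matrix.of fun p k => U p (e k) * (Real.sqrt (l (e k)) : ℂ), ?_, ?_⟩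
  · ext p q
    have hf : ∀ i, U p i * (l i : ℂ) * star (U q i) = U p i * (Real.sqrt (l i) : ℂ) *
        (star (U q i) * star (Real.sqrt (l i) : ℂ)) := fun i => by
      rw [Complex.star_def, Complex.conj_ofReal, ← hsq]
      ring
    conv_lhs => rw [hd]
    simp only [Matrix.mul_apply (M := U * _), Matrix.mul_apply (M := Matrix.of _),
      Matrix.conjTranspose_apply, Matrix.of_apply, Matrix.mul_diagonal, star_mul']
    rw [e.sum_comp (fun i : {i // l i ≠ 0} => U p i * (Real.sqrt (l i) : ℂ) *
      (star (U q i) * star (Real.sqrt (l i) : ℂ)))]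
    simp_rw [← hf]
    rw [← Finset.sum_subtype (Finset.univ.filter fun i => l i ≠ 0) (by simp)
      (fun i => U p i * (l i : ℂ) * star (U q i))]
    refine (Finset.sum_filter_of_ne (p := fun i => l i ≠ 0) fun i _ hi h0 => hi ?_).symm
    simp [h0]
  · have : (Matrix.of fun p k => U p (e k) * (Real.sqrt (l (e k)) : ℂ))ᴴ *
        (Matrix.of fun p k => U p (e k) * (Real.sqrt (l (e k)) : ℂ)) =
        Matrix.diagonal fun k => (l (e k) : ℂ) := by
      ext k k'
      have h := congrFun (congrFun hUU (e k)) (e k')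
      simp only [Matrix.mul_apply, Matrix.conjTranspose_apply, Matrix.of_apply, star_mul',
        Matrix.diagonal_apply, Matrix.one_apply] at h ⊢
      have h' : ∑ p, star (U p (e k)) * star (Real.sqrt (l (e k)) : ℂ) *
          (U p (e k') * (Real.sqrt (l (e k')) : ℂ)) =
          (Real.sqrt (l (e k)) : ℂ) * (Real.sqrt (l (e k')) : ℂ) *
          ∑ p, star (U p (e k)) * U p (e k') := by
        rw [Finset.mul_sum]
        refine Finset.sum_congr rfl fun p _ => ?_
        rw [Complex.star_def, Complex.conj_ofReal]
        ring
      rw [h', h]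
      by_cases hk : k = k'
      · subst hk
        simp [hsq]
      · have : (e k : κ) ≠ e k' := fun h => hk (e.injective (Subtype.ext h))
        simp [hk, this]
    rw [this, Matrix.isUnit_diagonal, Pi.isUnit_iff]
    exact fun k => isUnit_iff_ne_zero.mpr (Complex.ofReal_ne_zero.mpr (e k).2)

/-- Small Hermitian perturbations of the identity are positive semidefinite. -/
theorem exists_posSemidef_one_add_sub [Fintype σ] [DecidableEq σ] {c : Matrix σ σ ℂ}
    (hc : c.IsHermitian) : ∃ ε : ℝ, 0 < ε ∧ (1 + ε • c).PosSemidef ∧ (1 - ε • c).PosSemidef := by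
  obtain ⟨U, l, -, hUU, hdec, -⟩ := exists_unitary_diagonal hc
  have key : ∀ s : ℝ, (∀ i, 0 ≤ 1 + s * l i) → (1 + s • c).PosSemidef := by
    intro s hs
    have : 1 + s • c = U * Matrix.diagonal (fun i => ((1 + s * l i : ℝ) : ℂ)) * Uᴴ := by
      have hd : Matrix.diagonal (fun i => ((1 + s * l i : ℝ) : ℂ)) =
          1 + s • Matrix.diagonal (fun i => (l i : ℂ)) := by
        ext i j
        by_cases h : i = j
        · subst h; simp
        · simp [h]
      conv_lhs => rw [hdec]
      rw [hd, Matrix.mul_add, Matrix.add_mul, Matrix.mul_one, hUU, Matrix.mul_smul, Matrix.smul_mul]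
    rw [this]
    refine Matrix.PosSemidef.mul_mul_conjTranspose_same ?_ U
    exact Matrix.posSemidef_diagonal_iff.mpr fun i => by exact_mod_cast hs i
  -- The sum dominates every `|l i|`; the summand 1 keeps it positive when `c = 0`.
  have hS : 0 < 1 + ∑ i, |l i| := by positivity
  have hb : ∀ i, |(1 + ∑ i, |l i|)⁻¹ * l i| ≤ 1 := fun i => by
    rw [abs_mul, abs_of_pos (inv_pos.mpr hS), inv_mul_le_one₀ hS]
    linarith [Finset.single_le_sum (f := fun i => |l i|) (fun _ _ => abs_nonneg _)
      (Finset.mem_univ i)]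
  refine ⟨(1 + ∑ i, |l i|)⁻¹, inv_pos.mpr hS, key _ fun i => ?_, ?_⟩
  · linarith [neg_le_of_abs_le (hb i)]
  · rw [sub_eq_add_neg, ← neg_smul]
    refine key _ fun i => ?_
    linarith [le_of_abs_le (hb i)]

/-- If `W` has more columns than the dimension of `a`, then some nonzero Hermitian `c` makes the
partial trace of `W c W†` vanish. -/
theorem exists_isHermitian_partialTrace_eq_zero [Fintype a] [Fintype b] [Fintype σ]
    (W : Matrix (a × b) σ ℂ) (h : Fintype.card a < Fintype.card σ) :
    ∃ c : Matrix σ σ ℂ, c.IsHermitian ∧ c ≠ 0 ∧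
      ∀ i j, ∑ x, (W * c * Wᴴ) (i, x) (j, x) = 0 := by
  let T : Matrix σ σ ℂ →ₗ[ℂ] Matrix a a ℂ :=
    { toFun := fun c => Matrix.of fun i j => ∑ x, (W * c * Wᴴ) (i, x) (j, x)
      map_add' := fun c c' => by
        ext i j
        simp [Matrix.mul_add, Matrix.add_mul, Finset.sum_add_distrib]
      map_smul' := fun z c => by
        ext i j
        simp [Finset.mul_sum] }
  have hT : ∀ c, T cᴴ = (T c)ᴴ := fun c => by
    have : W * cᴴ * Wᴴ = (W * c * Wᴴ)ᴴ := by simp [Matrix.mul_assoc]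
    ext i j
    simp only [T, LinearMap.coe_mk, AddHom.coe_mk, Matrix.of_apply, this,
      Matrix.conjTranspose_apply, star_sum]
  have hker : LinearMap.ker T ≠ ⊥ := LinearMap.ker_ne_bot_of_finrank_lt (by
    simpa [Module.finrank_matrix] using Nat.mul_self_lt_mul_self h)
  obtain ⟨c, hc, hc0⟩ := (Submodule.ne_bot_iff _).mp hker
  rw [LinearMap.mem_ker] at hc
  have main : ∃ c : Matrix σ σ ℂ, c.IsHermitian ∧ c ≠ 0 ∧ T c = 0 := by
    -- The kernel is closed under adjoints, so it contains `c + c†`; if that vanishes, `c` is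
    -- anti-Hermitian and `i c` serves.
    by_cases h0 : c + cᴴ = 0
    · refine ⟨Complex.I • c, ?_, by simpa using hc0, by rw [map_smul, hc, smul_zero]⟩
      rw [Matrix.IsHermitian, Matrix.conjTranspose_smul, ← neg_eq_of_add_eq_zero_right h0]
      simp
    · exact ⟨c + cᴴ, Matrix.isHermitian_add_transpose_self c, h0, by simp [hT, hc]⟩
  obtain ⟨c, h1, h2, h3⟩ := main
  exact ⟨c, h1, h2, fun i j => congrFun (congrFun h3 i) j⟩

/-- Extreme Choi matrices have rank at most the input dimension. -/
theorem exists_factor_of_mem_extremePoints [Fintype a] [DecidableEq a] [Fintype b]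
    {J : Matrix (a × b) (a × b) ℂ} (hJ : J ∈ (choiSet a b).extremePoints ℝ) :
    ∃ (r : ℕ) (W : Matrix (a × b) (Fin r) ℂ), J = W * Wᴴ ∧ r ≤ Fintype.card a := by
  obtain ⟨r, W, hW, hu⟩ := exists_injective_factor hJ.1.1
  refine ⟨r, W, hW, ?_⟩
  by_contra! hr
  obtain ⟨c, hc, hc0, hT⟩ := exists_isHermitian_partialTrace_eq_zero W (by simpa using hr)
  obtain ⟨ε, hε, hp, hm⟩ := exists_posSemidef_one_add_sub hc
  have e1 : W * (1 + ε • c) * Wᴴ = J + ε • (W * c * Wᴴ) := by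
    simp [Matrix.mul_add, Matrix.add_mul, hW]
  have e2 : W * (1 - ε • c) * Wᴴ = J - ε • (W * c * Wᴴ) := by
    simp [Matrix.mul_sub, Matrix.sub_mul, hW]
  have m1 : J + ε • (W * c * Wᴴ) ∈ choiSet a b := by
    refine ⟨e1 ▸ hp.mul_mul_conjTranspose_same W, fun i j => ?_⟩
    simp only [Matrix.add_apply, Matrix.smul_apply, Finset.sum_add_distrib, ← Finset.smul_sum, hT,
      hJ.1.2, smul_zero, add_zero]
  have m2 : J - ε • (W * c * Wᴴ) ∈ choiSet a b := by
    refine ⟨e2 ▸ hm.mul_mul_conjTranspose_same W, fun i j => ?_⟩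
    simp only [Matrix.sub_apply, Matrix.smul_apply, Finset.sum_sub_distrib, ← Finset.smul_sum, hT,
      hJ.1.2, smul_zero, sub_zero]
  -- `J` is the midpoint of two channel Choi matrices, so extremality forces the perturbation to
  -- vanish.
  have h0 := hJ.2 m1 m2 ⟨1 / 2, 1 / 2, by norm_num, by norm_num, by norm_num, by
    module⟩
  have h1 : W * c * Wᴴ = 0 := by
    have := add_eq_left.mp h0
    exact (smul_eq_zero.mp this).resolve_left hε.ne'
  have h2 : (Wᴴ * W) * c * (Wᴴ * W) = 0 := by
    calc (Wᴴ * W) * c * (Wᴴ * W) = Wᴴ * (W * c * Wᴴ) * W := by simp only [Matrix.mul_assoc]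
      _ = 0 := by rw [h1]; simp
  rw [hu.mul_left_eq_zero, hu.mul_right_eq_zero] at h2
  exact hc0 h2

/-! ### The output norm as a convex function on a compact set -/

theorem schattenTwo_eq_norm [Fintype κ] (X : Matrix κ κ ℂ) :
    schattenTwo X = ‖(WithLp.toLp 2 fun p : κ × κ => X p.1 p.2 : EuclideanSpace ℂ (κ × κ))‖ := by
  rw [schattenTwo, EuclideanSpace.norm_eq]
  congr 1
  simp only [Matrix.trace, Matrix.diag, Matrix.mul_apply, Matrix.conjTranspose_apply,
    Complex.re_sum, Fintype.sum_prod_type]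
  rw [Finset.sum_comm]
  refine Finset.sum_congr rfl fun i _ => Finset.sum_congr rfl fun j _ => ?_
  rw [Complex.star_def, ← Complex.normSq_eq_conj_mul_self, Complex.ofReal_re,
    Complex.normSq_eq_norm_sq]

/-- The entries of the output state, as a real-linear function of the Choi matrix. -/
def outputVec [Fintype a] (Ψ : SuperOp A A') (X : Matrix (A × a) (A × a) ℂ) :
    Matrix (a × b) (a × b) ℂ →ₗ[ℝ] EuclideanSpace ℂ ((A' × b) × (A' × b)) where
  toFun J := WithLp.toLp 2 fun p => tensorId Ψ b (idTensor A (ofChoi J) X) p.1 p.2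
  map_add' J J' := by
    have : idTensor A (ofChoi (J + J')) X = idTensor A (ofChoi J) X + idTensor A (ofChoi J') X := by
      ext p q
      simp [idTensor, ofChoi, mul_add, Finset.sum_add_distrib]
    rw [this, map_add]
    rfl
  map_smul' s J := by
    have : idTensor A (ofChoi (s • J)) X = (s : ℂ) • idTensor A (ofChoi J) X := by
      ext p q
      simp [idTensor, ofChoi, Finset.mul_sum, mul_left_comm]
    rw [this, map_smul]
    rfl

theorem schattenTwo_eq_norm_outputVec [Fintype a] [Fintype A'] [Fintype b] (Ψ : SuperOp A A')
    (X : Matrix (A × a) (A × a) ℂ) (J : Matrix (a × b) (a × b) ℂ) :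
    schattenTwo (tensorId Ψ b (idTensor A (ofChoi J) X)) = ‖outputVec Ψ X J‖ :=
  schattenTwo_eq_norm _

theorem convex_choiSet [DecidableEq a] [Fintype b] : Convex ℝ (choiSet a b) := by
  intro J hJ J' hJ' s s' hs hs' hss
  refine ⟨(hJ.1.smul hs).add (hJ'.1.smul hs'), fun i j => ?_⟩
  simp only [Matrix.add_apply, Matrix.smul_apply, Finset.sum_add_distrib, ← Finset.smul_sum, hJ.2,
    hJ'.2, ← add_smul, hss, one_smul]

/-- Diagonal entries are nonnegative with block sums 1, hence at most 1; nonnegative 2×2 principal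
minors then control the other entries. -/
theorem norm_apply_le_one_of_mem_choiSet [Fintype a] [DecidableEq a] [Fintype b]
    {J : Matrix (a × b) (a × b) ℂ} (hJ : J ∈ choiSet a b) (p q : a × b) : ‖J p q‖ ≤ 1 := by
  have hd : ∀ p, 0 ≤ J p p ∧ J p p ≤ 1 := fun p => by
    refine ⟨hJ.1.diag_nonneg, ?_⟩
    have h := hJ.2 p.1 p.1
    rw [Matrix.one_apply_eq] at h
    rw [← h]
    exact Finset.single_le_sum (f := fun x => J (p.1, x) (p.1, x))
      (fun _ _ => hJ.1.diag_nonneg) (Finset.mem_univ p.2)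
  have hdet := (hJ.1.submatrix ![p, q]).det_nonneg
  have hqp : J q p = star (J p q) := (hJ.1.1.apply q p).symm
  rw [Matrix.det_fin_two] at hdet
  simp only [Matrix.submatrix_apply, Matrix.cons_val_zero, Matrix.cons_val_one, hqp,
    Complex.star_def, Complex.mul_conj, sub_nonneg] at hdet
  have h2 : J p p * J q q ≤ 1 := mul_le_one₀ (hd p).2 (hd q).1 (hd q).2
  have h3 : Complex.normSq (J p q) ≤ 1 := by exact_mod_cast hdet.trans h2
  rw [Complex.normSq_eq_norm_sq] at h3
  nlinarith [norm_nonneg (J p q)]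

section Topology

open scoped Matrix.Norms.Elementwise

theorem isCompact_choiSet [Fintype a] [DecidableEq a] [Fintype b] : IsCompact (choiSet a b) := by
  refine Metric.isCompact_of_isClosed_isBounded ?_ ?_
  · have : choiSet a b = {J | Jᴴ = J} ∩ (⋂ x : a × b → ℂ, {J | 0 ≤ star x ⬝ᵥ (J *ᵥ x)}) ∩
        ⋂ i, ⋂ j, {J | ∑ x, J (i, x) (j, x) = (1 : Matrix a a ℂ) i j} := by
      ext J
      simp [choiSet, Matrix.posSemidef_iff_dotProduct_mulVec, Matrix.IsHermitian]
    rw [this]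
    refine ((isClosed_eq (by fun_prop) (by fun_prop)).inter (isClosed_iInter fun x => ?_)).inter
      (isClosed_iInter fun i => isClosed_iInter fun j => isClosed_eq ?_ continuous_const)
    · exact isClosed_le continuous_const (by fun_prop)
    · fun_prop
  · refine (Metric.isBounded_closedBall (x := 0) (r := 1)).subset fun J hJ => ?_
    rw [mem_closedBall_zero_iff, Matrix.norm_le_iff zero_le_one]
    exact norm_apply_le_one_of_mem_choiSet hJ

theorem continuous_outputVec [Fintype a] [Fintype A'] [Fintype b] (Ψ : SuperOp A A')
    (X : Matrix (A × a) (A × a) ℂ) :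
    Continuous (outputVec (b := b) Ψ X) :=
  LinearMap.continuous_of_finiteDimensional _

/-- A bound on the output norm need only be checked at extreme Choi matrices. -/
theorem norm_outputVec_le_of_extremePoints [Fintype a] [DecidableEq a] [Fintype A'] [Fintype b]
    (Ψ : SuperOp A A') (X : Matrix (A × a) (A × a) ℂ) {C : ℝ}
    (h : ∀ J ∈ (choiSet a b).extremePoints ℝ, ‖outputVec Ψ X J‖ ≤ C)
    {J : Matrix (a × b) (a × b) ℂ} (hJ : J ∈ choiSet a b) : ‖outputVec Ψ X J‖ ≤ C := by
  have hcl : IsClosed {J : Matrix (a × b) (a × b) ℂ | ‖outputVec Ψ X J‖ ≤ C} :=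
    isClosed_le (continuous_outputVec Ψ X).norm continuous_const
  have hconv : Convex ℝ {J : Matrix (a × b) (a × b) ℂ | ‖outputVec Ψ X J‖ ≤ C} := by
    have := (convex_closedBall (0 : EuclideanSpace ℂ ((A' × b) × (A' × b))) C).linear_preimage
      (outputVec Ψ X)
    simpa [Set.preimage, mem_closedBall_zero_iff] using this
  have : LocallyConvexSpace ℝ (Matrix (a × b) (a × b) ℂ) :=
    inferInstanceAs (LocallyConvexSpace ℝ (a × b → a × b → ℂ))
  -- Krein–Milman: a closed convex sublevel set containing the extreme points contains everything.
  rw [← closure_convexHull_extremePoints isCompact_choiSet convex_choiSet] at hJ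
  exact closure_minimal (convexHull_min h hconv) hcl hJ

theorem choiSet_nonempty [DecidableEq a] [Fintype b] [Nonempty b] : (choiSet a b).Nonempty := by
  classical
  obtain ⟨x₀⟩ := ‹Nonempty b›
  -- The Choi matrix of the constant channel `X ↦ Tr(X) |x₀⟩⟨x₀|`.
  refine ⟨Matrix.diagonal fun p => if p.2 = x₀ then 1 else 0,
    Matrix.posSemidef_diagonal_iff.mpr fun p => by split_ifs <;> simp, fun i j => ?_⟩
  simp [Matrix.diagonal_apply, Matrix.one_apply]

theorem exists_max_outputVec [Fintype a] [DecidableEq a] [Fintype A'] [Fintype b] [Nonempty b]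
    (Ψ : SuperOp A A') (X : Matrix (A × a) (A × a) ℂ) :
    ∃ J ∈ choiSet a b, ∀ J' ∈ choiSet a b, ‖outputVec Ψ X J'‖ ≤ ‖outputVec Ψ X J‖ :=
  isCompact_choiSet.exists_isMaxOn choiSet_nonempty (continuous_outputVec Ψ X).norm.continuousOn

end Topology

/-! ### Reduction to the squared input dimension -/

/-- An output space of dimension `(dim a)²` is large enough. -/
theorem exists_schattenTwo_le [Fintype a] [DecidableEq a] [Fintype A] [DecidableEq A] [Fintype A']
    [DecidableEq A'] [Fintype b] [Nonempty b] (hb : Fintype.card a ^ 2 ≤ Fintype.card b)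
    (Ψ : SuperOp A A') (X : Matrix (A × a) (A × a) ℂ) :
    ∃ Λ : SuperOp a b, IsCPTP Λ ∧ ∀ (m : ℕ) (Λ' : SuperOp a (Fin m)), IsCPTP Λ' →
      schattenTwo (tensorId Ψ (Fin m) (idTensor A Λ' X)) ≤
        schattenTwo (tensorId Ψ b (idTensor A Λ X)) := by
  obtain ⟨J, hJ, hmax⟩ := exists_max_outputVec (b := b) Ψ X
  refine ⟨ofChoi J, isCPTP_ofChoi hJ, fun m Λ' hΛ' => ?_⟩
  rw [← ofChoi_choi Λ', schattenTwo_eq_norm_outputVec, schattenTwo_eq_norm_outputVec]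
  refine norm_outputVec_le_of_extremePoints Ψ X (fun J' hJ' => ?_) (choi_mem_choiSet hΛ')
  obtain ⟨r, W, hW, hr⟩ := exists_factor_of_mem_extremePoints hJ'
  set M : Matrix (Fin m) (a × Fin r) ℂ := Matrix.of fun x p => W (p.1, x) p.2
  have hM : ofChoi J' = stinespring M := by rw [hW, ofChoi_eq_stinespring]
  have hcard : Fintype.card (a × Fin r) ≤ Fintype.card b := by
    rw [Fintype.card_prod, Fintype.card_fin]
    exact (Nat.mul_le_mul_left _ hr).trans (by rwa [← sq])
  obtain ⟨M', hM'⟩ := exists_conjTranspose_mul_self_eq (b' := b) M hcard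
  -- Trace preservation depends only on the Gram matrix, so it passes from `M` to `M'`.
  have hcptp : IsCPTP (stinespring M') := by
    refine ⟨isCP_stinespring M', fun Y => ?_⟩
    rw [trace_stinespring, ← hM', ← trace_stinespring, ← hM, trace_ofChoi hJ'.1]
  rw [← schattenTwo_eq_norm_outputVec, hM, schattenTwo_stinespring_congr Ψ X hM',
    ← ofChoi_choi (stinespring M'), schattenTwo_eq_norm_outputVec]
  exact hmax _ (choi_mem_choiSet hcptp)

end FiniteOutput

end

theorem mainTheorem8 (d : ℕ) (hd : 2 ≤ d) (t : ℝ)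
    (ht₁ : -(1 / ((d : ℝ) - 1)) ≤ t) (ht₂ : t ≤ 1 / ((d : ℝ) + 1)) (n : ℕ) :
    IsLUB (FiniteOutput.allValues d t n) (FiniteOutput.upsilonTwo d t n) ∧
    IsGreatest (FiniteOutput.valuesAt d t n (d ^ (2 * n))) (FiniteOutput.upsilonTwo d t n) ∧
    IsGreatest (FiniteOutput.allValues d t n) (FiniteOutput.upsilonTwo d t n) := by
  have hD : 0 < d ^ (2 * n) := by positivity
  have : Nonempty (Fin (d ^ (2 * n))) := ⟨⟨0, hD⟩⟩
  obtain ⟨Λ, hΛ, hmax⟩ := FiniteOutput.exists_schattenTwo_le (b := Fin (d ^ (2 * n)))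
    (by simp [← pow_mul, mul_comm]) (FiniteOutput.tensorPow (FiniteOutput.transposeDepolarizing d t) n)
    (FiniteOutput.maxEntPow d n)
  have hmem : FiniteOutput.schattenTwo (FiniteOutput.omega d t n _ Λ) ∈
      FiniteOutput.valuesAt d t n (d ^ (2 * n)) := ⟨Λ, hΛ, rfl⟩
  have hsub : FiniteOutput.valuesAt d t n (d ^ (2 * n)) ⊆ FiniteOutput.allValues d t n :=
    Set.subset_iUnion (FiniteOutput.valuesAt d t n) _
  have hall : IsGreatest (FiniteOutput.allValues d t n)
      (FiniteOutput.schattenTwo (FiniteOutput.omega d t n _ Λ)) := by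
    refine ⟨hsub hmem, fun v hv => ?_⟩
    obtain ⟨m, Λ', hΛ', rfl⟩ := Set.mem_iUnion.mp hv
    exact hmax m Λ' hΛ'
  have hv : FiniteOutput.upsilonTwo d t n =
      FiniteOutput.schattenTwo (FiniteOutput.omega d t n _ Λ) := hall.csSup_eq
  rw [hv]
  exact ⟨hall.isLUB, ⟨hmem, fun v h => hall.2 (hsub h)⟩, hall⟩
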